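/- Work in the category of locales, the opposite of the category of frames (complete lattices with $x\wedge\bigvee_i y_i=\bigvee_i (x\wedge y_i)$, and maps preserving finite meets and all joins). For a locale $X$ write $\mathcal{O}X$ for its frame, and for a map of locales $f\colon X\to Y$ write $f^{-1}\colon\mathcal{O}Y\to\mathcal{O}X$ for its frame map. The map $f$ is called open if $f^{-1}$ has a left adjoint $f_!\colon\mathcal{O}X\to\mathcal{O}Y$ such that $f_!(U\wedge f^{-1}(V))=f_!(U)\wedge V$ for all $U\in\mathcal{O}X$, $V\in\mathcal{O}Y$. A localic relation on a locale $X$ is a sublocale $r\colon R\rightarrowtail X\times X$ of the product locale; its source and target maps are $s_R=\mathrm{pr}_1\circ r$ and $t_R=\mathrm{pr}_2\circ r$, from $R$ to $X$. It has open cones if $s_R$ and $t_R$ are both open, and in that case its cones are the maps $\mathcal{O}X\to\mathcal{O}X$ given by $$\uparrow_R\;=\;(t_R)_!\circ s_R^{-1},\qquad \downarrow_R\;=\;(s_R)_!\circ t_R^{-1}.$$ For localic relations $R,Q$ on $X$, let $P=R\times_X Q$ be the pullback of $t_R\colon R\to X$ and $s_Q\colon Q\to X$, with projections $\pi_R\colon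 P\to R$ and $\pi_Q\colon P\to Q$. The composite $R\circ Q$ is the localic relation on $X$ given by the image of $(s_R\circ\pi_R,\;t_Q\circ\pi_Q)\colon P\to X\times X$, where the image of a map of locales $f\colon Y\to Z$ is the sublocale of $Z$ with nucleus $f_*f^{-1}$, and $f_*$ is the right adjoint of $f^{-1}$ (equivalently, the smallest sublocale of $Z$ through which $f$ factors). **Proposition.** Let $X$ be a locale and let $R$ and $Q$ be localic relations on $X$ that have open cones. Then $R\circ Q$ has open cones, and $$\uparrow_{R\circ Q}\;=\;\uparrow_Q\circ\uparrow_R,\qquad \downarrow_{R\circ Q}\;=\;\downarrow_R\circ\downarrow_Q.$$ -/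

import Mathlib

open CategoryTheory CategoryTheory.Limits

universe u

namespace LocalicRel

/-! ### Pushouts of frames

The pushout of frame maps `f : C → A` and `g : C → B` is realised as the frame of those lower sets
of `A × B` which are closed under joins in each coordinate and do not distinguish
`(a ⊓ f c, b)` from `(a, b ⊓ g c)`. -/

section Pushout

variable {A B C : Type u} [Order.Frame A] [Order.Frame B] [Order.Frame C]

theorem mem_himp_iff {D E : LowerSet (A × B)} {x : A × B} :
    x ∈ D ⇨ E ↔ ∀ y ≤ x, y ∈ D → y ∈ E := by
  rw [← LowerSet.Iic_le, le_himp_iff]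
  constructor
  · intro h y hy hD
    exact h ⟨hy, hD⟩
  · rintro h y ⟨hy, hD⟩
    exact h y hy hD

/-- The pushout of `f` and `g`, as a sublocale set of the frame of lower sets of `A × B`. -/
def pushoutSublocale (f : FrameHom C A) (g : FrameHom C B) : Sublocale (LowerSet (A × B)) where
  carrier := {D | (∀ (S : Set A) (b : B), (∀ a ∈ S, (a, b) ∈ D) → (sSup S, b) ∈ D) ∧
    (∀ (a : A) (S : Set B), (∀ b ∈ S, (a, b) ∈ D) → (a, sSup S) ∈ D) ∧
    (∀ (a : A) (b : B) (c : C), (a ⊓ f c, b) ∈ D ↔ (a, b ⊓ g c) ∈ D)}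
  sInf_mem' := by
    intro s hs
    refine ⟨fun S b h => ?_, fun a S h => ?_, fun a b c => ?_⟩
    · simp only [LowerSet.mem_sInf_iff] at h ⊢
      exact fun D hD => (hs hD).1 S b fun a ha => h a ha D hD
    · simp only [LowerSet.mem_sInf_iff] at h ⊢
      exact fun D hD => (hs hD).2.1 a S fun b hb => h b hb D hD
    · simp only [LowerSet.mem_sInf_iff]
      exact forall₂_congr fun D hD => (hs hD).2.2 a b c
  himp_mem' := by
    rintro E D ⟨h1, h2, h3⟩
    refine ⟨fun S b h => ?_, fun a S h => ?_, fun a b c => ?_⟩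
    · rw [mem_himp_iff]
      rintro ⟨a', b'⟩ ⟨ha, hb⟩ hE
      have key : (sSup ((fun s => a' ⊓ s) '' S), b') ∈ D := by
        refine h1 _ _ ?_
        rintro _ ⟨s, hs, rfl⟩
        exact mem_himp_iff.1 (h s hs) _ ⟨inf_le_right, hb⟩ (E.lower (Prod.mk_le_mk.2 ⟨inf_le_left, le_refl b'⟩) hE)
      rw [sSup_image, ← inf_sSup_eq, inf_eq_left.2 ha] at key
      exact key
    · rw [mem_himp_iff]
      rintro ⟨a', b'⟩ ⟨ha, hb⟩ hE
      have key : (a', sSup ((fun s => b' ⊓ s) '' S)) ∈ D := by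
        refine h2 _ _ ?_
        rintro _ ⟨s, hs, rfl⟩
        exact mem_himp_iff.1 (h s hs) _ ⟨ha, inf_le_right⟩ (E.lower (Prod.mk_le_mk.2 ⟨le_refl a', inf_le_left⟩) hE)
      rw [sSup_image, ← inf_sSup_eq, inf_eq_left.2 hb] at key
      exact key
    · rw [mem_himp_iff, mem_himp_iff]
      constructor
      · rintro h ⟨a', b'⟩ ⟨ha, hb⟩ hE
        have hb1 : b' ≤ b := le_trans hb inf_le_left
        have hb2 : b' ≤ g c := le_trans hb inf_le_right
        have := h (a' ⊓ f c, b') ⟨inf_le_inf_right _ ha, hb1⟩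
          (E.lower (Prod.mk_le_mk.2 ⟨inf_le_left, le_refl b'⟩) hE)
        rwa [h3, inf_eq_left.2 hb2] at this
      · rintro h ⟨a', b'⟩ ⟨ha, hb⟩ hE
        have ha1 : a' ≤ a := le_trans ha inf_le_left
        have ha2 : a' ≤ f c := le_trans ha inf_le_right
        have := h (a', b' ⊓ g c) ⟨ha1, inf_le_inf_right _ hb⟩
          (E.lower (Prod.mk_le_mk.2 ⟨le_refl a', inf_le_left⟩) hE)
        rwa [← h3, inf_eq_left.2 ha2] at this

/-- The underlying frame of the pushout of `f` and `g`. -/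
abbrev PushoutFrame (f : FrameHom C A) (g : FrameHom C B) : Type u := ↥(pushoutSublocale f g)

variable (f : FrameHom C A) (g : FrameHom C B)

/-- The basic rectangle `a ⊗ b` in the pushout: the least element containing `(a, b)`. -/
def rect (a : A) (b : B) : PushoutFrame f g :=
  (pushoutSublocale f g).restrict (LowerSet.Iic (a, b))

variable {f g}

theorem rect_le_iff {a : A} {b : B} {D : PushoutFrame f g} :
    rect f g a b ≤ D ↔ (a, b) ∈ D.1 := by
  rw [rect, (pushoutSublocale f g).giRestrict.gc.le_iff_le, LowerSet.Iic_le]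

theorem rect_inf_rect (a a' : A) (b b' : B) :
    rect f g a b ⊓ rect f g a' b' = rect f g (a ⊓ a') (b ⊓ b') := by
  rw [rect, rect, rect, ← map_inf]
  congr 1
  exact (LowerSet.Iic_inf (a, b) (a', b')).symm

theorem rect_top_top : rect f g ⊤ ⊤ = ⊤ := by
  refine top_unique fun x _ => ?_
  exact (rect f g ⊤ ⊤).1.lower ⟨le_top, le_top⟩ (rect_le_iff.1 le_rfl)

theorem rect_mono {a a' : A} {b b' : B} (ha : a ≤ a') (hb : b ≤ b') :
    rect f g a b ≤ rect f g a' b' :=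
  rect_le_iff.2 ((rect f g a' b').1.lower ⟨ha, hb⟩ (rect_le_iff.1 le_rfl))

variable (f g) in
/-- The coprojection `a ↦ a ⊗ ⊤`. -/
def inl : FrameHom A (PushoutFrame f g) where
  toFun a := rect f g a ⊤
  map_inf' a a' := by rw [rect_inf_rect, inf_idem]
  map_top' := rect_top_top
  map_sSup' S := by
    refine le_antisymm (rect_le_iff.2 ?_) (sSup_le ?_)
    · exact (sSup ((fun a => rect f g a ⊤) '' S)).2.1 S ⊤ fun a ha =>
        rect_le_iff.1 (le_sSup ⟨a, ha, rfl⟩)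
    · rintro _ ⟨a, ha, rfl⟩
      exact rect_mono (le_sSup ha) le_rfl

variable (f g) in
/-- The coprojection `b ↦ ⊤ ⊗ b`. -/
def inr : FrameHom B (PushoutFrame f g) where
  toFun b := rect f g ⊤ b
  map_inf' a a' := by rw [rect_inf_rect, inf_idem]
  map_top' := rect_top_top
  map_sSup' S := by
    refine le_antisymm (rect_le_iff.2 ?_) (sSup_le ?_)
    · exact (sSup ((fun b => rect f g ⊤ b) '' S)).2.2.1 ⊤ S fun a ha =>
        rect_le_iff.1 (le_sSup ⟨a, ha, rfl⟩)
    · rintro _ ⟨a, ha, rfl⟩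
      exact rect_mono le_rfl (le_sSup ha)

theorem inl_inf_inr (a : A) (b : B) : inl f g a ⊓ inr f g b = rect f g a b := by
  change rect f g a ⊤ ⊓ rect f g ⊤ b = _
  rw [rect_inf_rect, inf_top_eq, top_inf_eq]

theorem inl_comp_eq : (inl f g).comp f = (inr f g).comp g := by
  ext c : 1
  change rect f g (f c) ⊤ = rect f g ⊤ (g c)
  refine le_antisymm (rect_le_iff.2 ?_) (rect_le_iff.2 ?_)
  · have h : ((⊤ : A), (⊤ : B) ⊓ g c) ∈ (rect f g ⊤ (g c)).1 := by
      rw [top_inf_eq]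
      exact rect_le_iff.1 le_rfl
    have h' := ((rect f g ⊤ (g c)).2.2.2 ⊤ ⊤ c).2 h
    rwa [top_inf_eq] at h'
  · have h : ((⊤ : A) ⊓ f c, (⊤ : B)) ∈ (rect f g (f c) ⊤).1 := by
      rw [top_inf_eq]
      exact rect_le_iff.1 le_rfl
    have h' := ((rect f g (f c) ⊤).2.2.2 ⊤ ⊤ c).1 h
    rwa [top_inf_eq] at h'

theorem eq_iSup_rect (D : PushoutFrame f g) :
    D = sSup {E | ∃ x ∈ D.1, E = inl f g x.1 ⊓ inr f g x.2} := by
  refine le_antisymm ?_ (sSup_le ?_)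
  · intro x hx
    refine rect_le_iff.1 ?_
    rw [← inl_inf_inr]
    exact le_sSup ⟨x, hx, rfl⟩
  · rintro _ ⟨x, hx, rfl⟩
    rw [inl_inf_inr]
    exact rect_le_iff.2 hx

variable {N : Type u} [Order.Frame N]

/-- The right adjoint of the frame map out of the pushout induced by `h` and `k`. -/
def descRight (h : FrameHom A N) (k : FrameHom B N) (w : h.comp f = k.comp g) (n : N) :
    PushoutFrame f g :=
  ⟨⟨{x | h x.1 ⊓ k x.2 ≤ n}, fun _ _ hxy hx => le_trans
      (inf_le_inf (OrderHomClass.mono h hxy.1) (OrderHomClass.mono k hxy.2)) hx⟩, by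
    refine ⟨fun S b hS => ?_, fun a S hS => ?_, fun a b c => ?_⟩
    · change h (sSup S) ⊓ k b ≤ n
      rw [map_sSup, sSup_inf_eq]
      refine iSup₂_le ?_
      rintro _ ⟨a, ha, rfl⟩
      exact hS a ha
    · change h a ⊓ k (sSup S) ≤ n
      rw [map_sSup, inf_sSup_eq]
      refine iSup₂_le ?_
      rintro _ ⟨b, hb, rfl⟩
      exact hS b hb
    · change h (a ⊓ f c) ⊓ k b ≤ n ↔ h a ⊓ k (b ⊓ g c) ≤ n
      have hc : h (f c) = k (g c) := DFunLike.congr_fun w c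
      rw [map_inf, map_inf, hc, inf_assoc, inf_comm (k (g c))]⟩

theorem desc_gc (h : FrameHom A N) (k : FrameHom B N) (w : h.comp f = k.comp g) :
    GaloisConnection (fun D : PushoutFrame f g => ⨆ x ∈ D.1, h x.1 ⊓ k x.2)
      (descRight h k w) := by
  intro D n
  exact iSup₂_le_iff

/-- The frame map out of the pushout induced by `h` and `k`. -/
def desc (h : FrameHom A N) (k : FrameHom B N) (w : h.comp f = k.comp g) :
    FrameHom (PushoutFrame f g) N where
  toFun D := ⨆ x ∈ D.1, h x.1 ⊓ k x.2
  map_inf' D E := by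
    refine le_antisymm ((desc_gc h k w).monotone_l.map_inf_le D E) ?_
    rw [iSup₂_inf_eq]
    refine iSup₂_le fun x hx => ?_
    rw [inf_iSup₂_eq]
    refine iSup₂_le fun y hy => ?_
    refine le_trans (le_of_eq ?_)
      (le_iSup₂ (f := fun (z : A × B) (_ : z ∈ (D ⊓ E).1) => h z.1 ⊓ k z.2) (x ⊓ y)
        ⟨D.1.lower inf_le_left hx, E.1.lower inf_le_right hy⟩)
    change _ = h (x.1 ⊓ y.1) ⊓ k (x.2 ⊓ y.2)
    rw [map_inf, map_inf, inf_inf_inf_comm]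
  map_top' := by
    refine top_unique (le_trans (le_of_eq ?_)
      (le_iSup₂ (f := fun (z : A × B) (_ : z ∈ (⊤ : PushoutFrame f g).1) => h z.1 ⊓ k z.2)
        (⊤, ⊤) trivial))
    rw [map_top, map_top, inf_top_eq]
  map_sSup' S := by
    rw [(desc_gc h k w).l_sSup, sSup_image]

theorem desc_rect (h : FrameHom A N) (k : FrameHom B N) (w : h.comp f = k.comp g)
    (a : A) (b : B) : desc h k w (rect f g a b) = h a ⊓ k b := by
  refine le_antisymm (((desc_gc h k w) _ _).2 (rect_le_iff.2 (le_refl (h a ⊓ k b)))) ?_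
  exact le_iSup₂ (f := fun (z : A × B) (_ : z ∈ (rect f g a b).1) => h z.1 ⊓ k z.2)
    (a, b) (rect_le_iff.1 le_rfl)

theorem desc_comp_inl (h : FrameHom A N) (k : FrameHom B N) (w : h.comp f = k.comp g) :
    (desc h k w).comp (inl f g) = h := by
  ext a : 1
  change desc h k w (rect f g a ⊤) = h a
  rw [desc_rect, map_top, inf_top_eq]

theorem desc_comp_inr (h : FrameHom A N) (k : FrameHom B N) (w : h.comp f = k.comp g) :
    (desc h k w).comp (inr f g) = k := by
  ext b : 1
  change desc h k w (rect f g ⊤ b) = k b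
  rw [desc_rect, map_top, top_inf_eq]

theorem pushout_hom_ext {p q : FrameHom (PushoutFrame f g) N}
    (h1 : p.comp (inl f g) = q.comp (inl f g)) (h2 : p.comp (inr f g) = q.comp (inr f g)) :
    p = q := by
  ext D : 1
  rw [eq_iSup_rect D, map_sSup, map_sSup]
  congr 1
  refine Set.image_congr ?_
  rintro _ ⟨x, -, rfl⟩
  have e1 : p (inl f g x.1) = q (inl f g x.1) := DFunLike.congr_fun h1 x.1
  have e2 : p (inr f g x.2) = q (inr f g x.2) := DFunLike.congr_fun h2 x.2
  rw [map_inf, map_inf, e1, e2]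

end Pushout

theorem isPushout {C A B : Frm.{u}} (f : C ⟶ A) (g : C ⟶ B) :
    IsPushout f g (Frm.ofHom (inl f.hom g.hom)) (Frm.ofHom (inr f.hom g.hom)) where
  w := Frm.hom_ext inl_comp_eq
  isColimit' := ⟨PushoutCocone.IsColimit.mk _
    (fun s => Frm.ofHom (desc s.inl.hom s.inr.hom (congrArg Frm.Hom.hom s.condition)))
    (fun s => Frm.hom_ext (desc_comp_inl _ _ (congrArg Frm.Hom.hom s.condition)))
    (fun s => Frm.hom_ext (desc_comp_inr _ _ (congrArg Frm.Hom.hom s.condition)))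
    (fun s _ h1 h2 => Frm.hom_ext (pushout_hom_ext
      ((congrArg Frm.Hom.hom h1).trans (desc_comp_inl _ _ (congrArg Frm.Hom.hom s.condition)).symm)
      ((congrArg Frm.Hom.hom h2).trans (desc_comp_inr _ _ (congrArg Frm.Hom.hom s.condition)).symm)))⟩

instance : HasPushouts Frm.{u} :=
  have (C A B : Frm.{u}) (f : C ⟶ A) (g : C ⟶ B) : HasColimit (span f g) :=
    (isPushout f g).hasPushout
  hasPushouts_of_hasColimit_span _

/-- The frame map out of the frame of truth values (subsets of a point). -/
def ofTruth (N : Type u) [Order.Frame N] : FrameHom (Set PUnit.{u + 1}) N where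
  toFun S := ⨆ _ : PUnit.unit ∈ S, ⊤
  map_inf' S T := by
    by_cases h1 : PUnit.unit ∈ S <;> by_cases h2 : PUnit.unit ∈ T <;> simp [h1, h2]
  map_top' := by simp
  map_sSup' S := by
    refine le_antisymm (iSup_le ?_) (sSup_le ?_)
    · rintro ⟨T, hT, h⟩
      exact le_trans (by simp [h]) (le_sSup ⟨T, hT, rfl⟩)
    · rintro _ ⟨T, hT, rfl⟩
      exact iSup_le fun h => le_iSup (fun _ : PUnit.unit ∈ sSup S => (⊤ : N)) ⟨T, hT, h⟩

theorem ofTruth_unique {N : Type u} [Order.Frame N] (h : FrameHom (Set PUnit.{u + 1}) N) :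
    h = ofTruth N := by
  ext S : 1
  by_cases hS : PUnit.unit ∈ S
  · have : S = ⊤ := Set.eq_univ_of_forall fun _ => hS
    rw [this, map_top, map_top]
  · have : S = ⊥ := Set.eq_empty_of_forall_notMem fun _ => hS
    rw [this, map_bot, map_bot]

instance : HasInitial Frm.{u} :=
  (IsInitial.ofUniqueHom (X := Frm.of (Set PUnit.{u + 1})) (fun N => Frm.ofHom (ofTruth N))
    fun _ m => Frm.hom_ext (ofTruth_unique m.hom)).hasInitial

instance : HasPullbacks Locale.{u} := inferInstanceAs (HasPullbacks Frm.{u}ᵒᵖ)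

instance : HasTerminal Locale.{u} := inferInstanceAs (HasTerminal Frm.{u}ᵒᵖ)

instance : HasBinaryProducts Locale.{u} := hasBinaryProducts_of_hasTerminal_and_pullbacks _

/-! ### Maps of locales -/

/-- The frame map `f⁻¹ : 𝒪 Y → 𝒪 X` underlying a map of locales `f : X ⟶ Y`. -/
def preimage {X Y : Locale.{u}} (f : X ⟶ Y) : FrameHom Y X :=
  Frm.Hom.hom (Quiver.Hom.unop f)

/-- A map of locales is open if its frame map has a left adjoint satisfying Frobenius
reciprocity. -/
def IsOpenMap {X Y : Locale.{u}} (f : X ⟶ Y) : Prop :=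
  ∃ l : X → Y, GaloisConnection l (preimage f) ∧
    ∀ (U : X) (V : Y), l (U ⊓ preimage f V) = l U ⊓ V

/-- The map `f_!`, given by the formula for the left adjoint of `f⁻¹`. -/
def lowerAdjoint {X Y : Locale.{u}} (f : X ⟶ Y) (U : X) : Y :=
  sInf {V | U ≤ preimage f V}

/-- For an open map, `f_!` is indeed the left adjoint of `f⁻¹`. -/
theorem IsOpenMap.gc {X Y : Locale.{u}} {f : X ⟶ Y} (hf : IsOpenMap f) :
    GaloisConnection (lowerAdjoint f) (preimage f) := by
  obtain ⟨l, hl, -⟩ := hf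
  have : lowerAdjoint f = l := by
    funext U
    exact le_antisymm (sInf_le (hl.le_u_l U)) (le_sInf fun V hV => hl.l_le hV)
  rwa [this]

/-- The right adjoint `f_*` of `f⁻¹`. -/
def directImage {X Y : Locale.{u}} (f : X ⟶ Y) (U : X) : Y :=
  sSup {V | preimage f V ≤ U}

theorem gc_directImage {X Y : Locale.{u}} (f : X ⟶ Y) :
    GaloisConnection (preimage f) (directImage f) := by
  intro V U
  refine ⟨fun h => le_sSup h, fun h => le_trans (OrderHomClass.mono (preimage f) h) ?_⟩
  rw [directImage, map_sSup]
  exact sSup_le (by rintro _ ⟨W, hW, rfl⟩; exact hW)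

/-- The image of a map of locales `f : X ⟶ Y`: the sublocale of `Y` whose nucleus is
`f_* f⁻¹`. -/
def image {X Y : Locale.{u}} (f : X ⟶ Y) : Sublocale Y :=
  Nucleus.toSublocale
    { toFun := fun V => directImage f (preimage f V)
      map_inf' := fun V W => by rw [map_inf, (gc_directImage f).u_inf]
      idempotent' := fun V => le_of_eq ((gc_directImage f).u_l_u_eq_u _)
      le_apply' := fun V => (gc_directImage f).le_u_l V }

/-- A sublocale, as a locale in its own right. -/
abbrev subLoc {X : Locale.{u}} (S : Sublocale X) : Locale.{u} := Locale.of S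

/-- The inclusion of a sublocale; its frame map is the quotient map `S.restrict`. -/
def inclusion {X : Locale.{u}} (S : Sublocale X) : subLoc S ⟶ X :=
  Quiver.Hom.op (Frm.ofHom S.restrict)

/-! ### Localic relations -/

/-- A localic relation on `X` is a sublocale of `X × X`. -/
abbrev Relation (X : Locale.{u}) : Type u := Sublocale ↥(X ⨯ X)

namespace Relation

variable {X : Locale.{u}}

/-- The source map `R ⟶ X`. -/
noncomputable def source (R : Relation X) : subLoc R ⟶ X := inclusion R ≫ prod.fst

/-- The target map `R ⟶ X`. -/
noncomputable def target (R : Relation X) : subLoc R ⟶ X := inclusion R ≫ prod.snd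

/-- A relation has open cones if its source and target maps are open. -/
def HasOpenCones (R : Relation X) : Prop := IsOpenMap R.source ∧ IsOpenMap R.target

/-- The up cone `t_! s⁻¹`. -/
noncomputable def up (R : Relation X) : X → X :=
  fun U => lowerAdjoint R.target (preimage R.source U)

/-- The down cone `s_! t⁻¹`. -/
noncomputable def down (R : Relation X) : X → X :=
  fun U => lowerAdjoint R.source (preimage R.target U)

/-- The composite `R ∘ Q` (first `R`, then `Q`): the image in `X × X` of the map
`(s_R π_R, t_Q π_Q)` from the pullback of `t_R` and `s_Q`. -/
noncomputable def comp (R Q : Relation X) : Relation X :=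
  image (prod.lift (pullback.fst R.target Q.source ≫ R.source)
    (pullback.snd R.target Q.source ≫ Q.target))

end Relation

end LocalicRel

namespace LocalicRel

/-! ### Open maps: composites, isomorphisms, and cancellation of surjections. -/

section OpenMaps

variable {X Y Z : Locale.{u}}

/-! Let `e : P ⟶ R ∘ Q` be the surjection from the pullback `P` onto the image. Since `e⁻¹` reflects
the order, openness of `e ≫ t` forces openness of `t`, with `t_! = (e ≫ t)_! e⁻¹`; so the cones of
`R ∘ Q` can be computed on `P` (`IsOpenMap.of_comp`, `lowerAdjoint_preimage_of_comp`). On `P` the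
legs are composites of open maps, because open maps are stable under pullback, and Beck–Chevalley
gives `(π_Q)_! π_R⁻¹ = s_Q⁻¹ (t_R)_!` (`IsOpenMap.fst_of_isPullback`). Hence `t_! s⁻¹ = (t_Q)_!
(π_Q)_! π_R⁻¹ s_R⁻¹ = (t_Q)_! s_Q⁻¹ (t_R)_! s_R⁻¹`, and symmetrically for the down cones. The
pullback result is proved on the explicit pushout of frames, where the left adjoint of the
coprojection sends `a ⊗ b` to `a ⊓ f (l b)`, with `l` the left adjoint of `g`. -/

theorem preimage_comp (f : X ⟶ Y) (g : Y ⟶ Z) (W : Z) :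
    preimage (f ≫ g) W = preimage f (preimage g W) := rfl

theorem lowerAdjoint_eq {f : X ⟶ Y} {l : X → Y} (hl : GaloisConnection l (preimage f)) :
    lowerAdjoint f = l := by
  funext U
  exact le_antisymm (sInf_le (hl.le_u_l U)) (le_sInf fun V hV => hl.l_le hV)

theorem IsOpenMap.frobenius {f : X ⟶ Y} (hf : IsOpenMap f) (U : X) (V : Y) :
    lowerAdjoint f (U ⊓ preimage f V) = lowerAdjoint f U ⊓ V := by
  obtain ⟨l, hl, h⟩ := hf
  rw [lowerAdjoint_eq hl]
  exact h U V

/-- If `e ≫ p` is open and `e⁻¹` reflects the order, then `p` is open, with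
`p_! = (e ≫ p)_! e⁻¹`. -/
theorem gc_of_comp {e : X ⟶ Y} {p : Y ⟶ Z} (h : IsOpenMap (e ≫ p))
    (he : ∀ U V : Y, preimage e U ≤ preimage e V → U ≤ V) :
    GaloisConnection (fun U => lowerAdjoint (e ≫ p) (preimage e U)) (preimage p) := by
  intro U V
  refine (h.gc _ _).trans ⟨fun h' => he _ _ h', fun h' => OrderHomClass.mono (preimage e) h'⟩

theorem IsOpenMap.of_comp {e : X ⟶ Y} {p : Y ⟶ Z} (h : IsOpenMap (e ≫ p))
    (he : ∀ U V : Y, preimage e U ≤ preimage e V → U ≤ V) : IsOpenMap p := by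
  refine ⟨_, gc_of_comp h he, fun U V => ?_⟩
  rw [map_inf]
  exact h.frobenius _ V

/-- Lets a cone of the image relation be computed on the span `P` that covers it. -/
theorem lowerAdjoint_preimage_of_comp {P : Locale.{u}} {e : P ⟶ Z} {s : Z ⟶ X} {t : Z ⟶ Y}
    {s' : P ⟶ X} {t' : P ⟶ Y} (hs : e ≫ s = s') (ht : e ≫ t = t') (ho : IsOpenMap t')
    (he : ∀ U V : Z, preimage e U ≤ preimage e V → U ≤ V) (U : X) :
    lowerAdjoint t (preimage s U) = lowerAdjoint t' (preimage s' U) := by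
  subst hs ht
  exact congrFun (lowerAdjoint_eq (gc_of_comp ho he)) _

theorem IsOpenMap.lowerAdjoint_comp {f : X ⟶ Y} {g : Y ⟶ Z} (hf : IsOpenMap f)
    (hg : IsOpenMap g) : lowerAdjoint (f ≫ g) = lowerAdjoint g ∘ lowerAdjoint f :=
  lowerAdjoint_eq (hf.gc.compose hg.gc)

theorem IsOpenMap.comp {f : X ⟶ Y} {g : Y ⟶ Z} (hf : IsOpenMap f) (hg : IsOpenMap g) :
    IsOpenMap (f ≫ g) := by
  refine ⟨_, hf.gc.compose hg.gc, fun U V => ?_⟩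
  rw [Function.comp_apply, Function.comp_apply, preimage_comp, hf.frobenius, hg.frobenius]

theorem preimage_hom_inv (e : X ≅ Y) (U : X) : preimage e.hom (preimage e.inv U) = U := by
  rw [← preimage_comp, e.hom_inv_id]
  rfl

theorem preimage_inv_hom (e : X ≅ Y) (V : Y) : preimage e.inv (preimage e.hom V) = V :=
  preimage_hom_inv e.symm V

theorem gc_iso (e : X ≅ Y) : GaloisConnection (preimage e.inv) (preimage e.hom) := by
  intro U V
  constructor
  · intro h
    have := OrderHomClass.mono (preimage e.hom) h
    rwa [preimage_hom_inv] at this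
  · intro h
    have := OrderHomClass.mono (preimage e.inv) h
    rwa [preimage_inv_hom] at this

theorem isOpenMap_iso (e : X ≅ Y) : IsOpenMap e.hom := by
  refine ⟨_, gc_iso e, fun U V => ?_⟩
  rw [map_inf, preimage_inv_hom]

end OpenMaps

/-! ### Pullbacks of open maps -/

section PushoutOpen

variable {A B C : Type u} [Order.Frame A] [Order.Frame B] [Order.Frame C]
  {f : FrameHom C A} {g : FrameHom C B} {l : B → C}

/-- An element is the join of the rectangles it contains, so it suffices that `a ⊗ b ≤ a' ⊗ ⊤`
exactly when `a ⊓ f (l b) ≤ a'`. -/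
theorem gc_inl (hl : GaloisConnection l g) (hF : ∀ b c, l (b ⊓ g c) = l b ⊓ c) :
    GaloisConnection (fun D : PushoutFrame f g => ⨆ x ∈ D.1, x.1 ⊓ f (l x.2)) (inl f g) := by
  intro D a'
  refine iSup₂_le_iff.trans ⟨?_, ?_⟩
  · rintro h ⟨a, b⟩ hx
    -- The balancing condition moves `f (l b)` across as `g (l b)`, which lies above `b` by the unit
    -- of the adjunction.
    have h1 : (a ⊓ f (l b), (⊤ : B)) ∈ (inl f g a').1 :=
      (inl f g a').1.lower (Prod.mk_le_mk.2 ⟨h (a, b) hx, le_rfl⟩)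
        (rect_le_iff.1 (le_refl (rect f g a' ⊤)))
    have h2 := ((inl f g a').2.2.2 a ⊤ (l b)).1 h1
    rw [top_inf_eq] at h2
    exact (inl f g a').1.lower (Prod.mk_le_mk.2 ⟨le_rfl, hl.le_u_l b⟩) h2
  · intro h x hx
    -- The rectangles satisfying the desired inequality form an element `E` of the pushout;
    -- Frobenius for `l` is exactly what makes it balanced. As `E` contains `(a', ⊤)`, it lies above
    -- `a' ⊗ ⊤`.
    let E : PushoutFrame f g :=
      ⟨⟨{x | x.1 ⊓ f (l x.2) ≤ a'}, fun _ _ hxy hx => le_trans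
        (inf_le_inf hxy.1 (OrderHomClass.mono f (hl.monotone_l hxy.2))) hx⟩, by
        refine ⟨fun S b hS => ?_, fun a S hS => ?_, fun a b c => ?_⟩
        · change sSup S ⊓ f (l b) ≤ a'
          rw [sSup_inf_eq]
          exact iSup₂_le fun a ha => hS a ha
        · change a ⊓ f (l (sSup S)) ≤ a'
          rw [hl.l_sSup, map_iSup₂, inf_iSup₂_eq]
          exact iSup₂_le fun b hb => hS b hb
        · change a ⊓ f c ⊓ f (l b) ≤ a' ↔ a ⊓ f (l (b ⊓ g c)) ≤ a'
          rw [hF, map_inf, inf_assoc, inf_comm (f c)]⟩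
    have hE : inl f g a' ≤ E := rect_le_iff.2 (inf_le_left : a' ⊓ f (l ⊤) ≤ a')
    exact hE (h hx)

theorem frobenius_inl (hl : GaloisConnection l g) (hF : ∀ b c, l (b ⊓ g c) = l b ⊓ c)
    (D : PushoutFrame f g) (a' : A) :
    (⨆ x ∈ (D ⊓ inl f g a').1, x.1 ⊓ f (l x.2)) = (⨆ x ∈ D.1, x.1 ⊓ f (l x.2)) ⊓ a' := by
  refine le_antisymm (le_inf ?_ ?_) ?_
  · exact iSup₂_le fun x hx =>
      le_iSup₂ (f := fun (x : A × B) (_ : x ∈ D.1) => x.1 ⊓ f (l x.2)) x hx.1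
  · exact (gc_inl hl hF).l_le inf_le_right
  · rw [iSup₂_inf_eq]
    refine iSup₂_le fun x hx => ?_
    rw [inf_right_comm]
    -- Shrinking the first side of the rectangle to `x.1 ⊓ a'` puts it inside `a' ⊗ ⊤` while keeping
    -- it in `D`.
    refine le_iSup₂ (f := fun (x : A × B) (_ : x ∈ (D ⊓ inl f g a').1) => x.1 ⊓ f (l x.2))
      (x.1 ⊓ a', x.2) ⟨D.1.lower (Prod.mk_le_mk.2 ⟨inf_le_left, le_rfl⟩) hx, ?_⟩
    exact (inl f g a').1.lower (Prod.mk_le_mk.2 ⟨inf_le_right, le_top⟩)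
      (rect_le_iff.1 (le_refl (rect f g a' ⊤)))

/-- Beck–Chevalley in frame form: the rectangle `⊤ ⊗ b` contributes `f (l b)`, and `⊤ ⊗ b ≤ f (l b)
⊗ ⊤` bounds the join from above. -/
theorem iSup_inr (hl : GaloisConnection l g) (hF : ∀ b c, l (b ⊓ g c) = l b ⊓ c) (b : B) :
    (⨆ x ∈ (inr f g b).1, x.1 ⊓ f (l x.2)) = f (l b) := by
  refine le_antisymm ?_ ?_
  · refine (gc_inl hl hF).l_le (rect_le_iff.2 ?_)
    have h1 : ((⊤ : A) ⊓ f (l b), (⊤ : B)) ∈ (inl f g (f (l b))).1 := by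
      rw [top_inf_eq]
      exact rect_le_iff.1 (le_refl (rect f g (f (l b)) ⊤))
    have h2 := ((inl f g (f (l b))).2.2.2 ⊤ ⊤ (l b)).1 h1
    rw [top_inf_eq] at h2
    exact (inl f g (f (l b))).1.lower (Prod.mk_le_mk.2 ⟨le_rfl, hl.le_u_l b⟩) h2
  · refine le_trans (le_of_eq (top_inf_eq _).symm)
      (le_iSup₂ (f := fun (x : A × B) (_ : x ∈ (inr f g b).1) => x.1 ⊓ f (l x.2))
        (⊤, b) (rect_le_iff.1 (le_refl (rect f g ⊤ b))))

end PushoutOpen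

section Pullback

variable {P X Y Z : Locale.{u}} {p : P ⟶ X} {q : P ⟶ Y} {f : X ⟶ Z} {g : Y ⟶ Z}

theorem exists_iso_of_isPullback (h : IsPullback p q f g) :
    ∃ e : P ≅ Locale.of (PushoutFrame (preimage f) (preimage g)),
      p = e.hom ≫ Quiver.Hom.op (Frm.ofHom (inl (preimage f) (preimage g))) ∧
      q = e.hom ≫ Quiver.Hom.op (Frm.ofHom (inr (preimage f) (preimage g))) := by
  have h' := (isPushout (Quiver.Hom.unop f) (Quiver.Hom.unop g)).op.flip
  exact ⟨h.isoIsPullback _ _ h', (h.isoIsPullback_hom_fst _ _ h').symm,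
    (h.isoIsPullback_hom_snd _ _ h').symm⟩

/-- Open maps are stable under pullback and satisfy the Beck–Chevalley condition. -/
theorem IsOpenMap.fst_of_isPullback (h : IsPullback p q f g) (hg : IsOpenMap g) :
    IsOpenMap p ∧ ∀ V : Y, lowerAdjoint p (preimage q V) = preimage f (lowerAdjoint g V) := by
  obtain ⟨e, rfl, rfl⟩ := exists_iso_of_isPullback h
  have gc := gc_inl (f := preimage f) hg.gc hg.frobenius
  have ho : IsOpenMap (X := Locale.of (PushoutFrame (preimage f) (preimage g))) (Y := X)
      (Quiver.Hom.op (Frm.ofHom (inl (preimage f) (preimage g)))) :=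
    ⟨_, gc, fun D a => frobenius_inl hg.gc hg.frobenius D a⟩
  refine ⟨(isOpenMap_iso e).comp ho, fun V => ?_⟩
  refine (congrFun ((isOpenMap_iso e).lowerAdjoint_comp ho) _).trans ?_
  refine (congrArg (lowerAdjoint _) ?_).trans ((congrFun (lowerAdjoint_eq gc) _).trans
    (iSup_inr hg.gc hg.frobenius V))
  -- For an isomorphism, `e_!` is the inverse of `e⁻¹`, so it cancels against the comparison with
  -- the explicit pushout.
  exact (congrFun (lowerAdjoint_eq (gc_iso e)) _).trans (preimage_inv_hom e _)

end Pullback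

/-! ### Images -/

section Image

variable {X Y : Locale.{u}}

theorem preimage_restrict_image (f : X ⟶ Y) (V : Y) :
    preimage f ((image f).restrict V).1 = preimage f V := by
  rw [image, Nucleus.restrict_toSublocale]
  exact (gc_directImage f).l_u_l_eq_l V

/-- The frame map of the corestriction of `f` to its image. -/
def imageLift (f : X ⟶ Y) : FrameHom (image f) X where
  toFun U := preimage f U.1
  map_inf' U V := map_inf (preimage f) U.1 V.1
  map_top' := map_top (preimage f)
  map_sSup' S := by
    -- A join in the sublocale is the nucleus applied to the ambient join, and `f⁻¹` does not see
    -- the nucleus.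
    rw [← (image f).giRestrict.l_sSup_u_image, preimage_restrict_image, map_sSup, Set.image_image]

/-- Elements of the image are fixed by `f_* f⁻¹`, so the inequality transposes to `U ≤ f_* f⁻¹ V =
V`. -/
theorem le_of_preimage_le {f : X ⟶ Y} {U V : image f}
    (h : preimage f U.1 ≤ preimage f V.1) : U ≤ V := by
  obtain ⟨W, hW⟩ := V.2
  have hV : directImage f (preimage f V.1) = V.1 := by
    rw [← hW]
    exact (gc_directImage f).u_l_u_eq_u _
  exact Subtype.coe_le_coe.1 (((gc_directImage f).le_u h).trans hV.le)

/-- A map of locales factors through its image by a surjection. -/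
theorem exists_factor_image (f : X ⟶ Y) :
    ∃ e : X ⟶ subLoc (image f), e ≫ inclusion (image f) = f ∧
      ∀ U V : subLoc (image f), preimage e U ≤ preimage e V → U ≤ V := by
  refine ⟨Quiver.Hom.op (Frm.ofHom (imageLift f)), ?_, fun U V h => le_of_preimage_le h⟩
  refine Quiver.Hom.unop_inj (Frm.hom_ext ?_)
  ext V : 1
  exact preimage_restrict_image f V

end Image

end LocalicRel

/-! ### The cones of a composite relation. -/

theorem mainTheorem9 (X : Locale.{u}) (R Q : LocalicRel.Relation X)
    (hR : R.HasOpenCones) (hQ : Q.HasOpenCones) :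
    (R.comp Q).HasOpenCones ∧
      (R.comp Q).up = Q.up ∘ R.up ∧
      (R.comp Q).down = R.down ∘ Q.down := by
  obtain ⟨hRs, hRt⟩ := hR
  obtain ⟨hQs, hQt⟩ := hQ
  have sq := IsPullback.of_hasPullback R.target Q.source
  obtain ⟨hp, bcp⟩ := LocalicRel.IsOpenMap.fst_of_isPullback sq hQs
  -- Each projection inherits openness from the opposite leg: `π_R` from `s_Q`, and `π_Q` from
  -- `t_R`.
  obtain ⟨hq, bcq⟩ := LocalicRel.IsOpenMap.fst_of_isPullback sq.flip hRt
  obtain ⟨e, he, hinj⟩ : ∃ e : pullback R.target Q.source ⟶ LocalicRel.subLoc (R.comp Q),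
      e ≫ LocalicRel.inclusion (R.comp Q) = prod.lift
        (pullback.fst R.target Q.source ≫ R.source) (pullback.snd R.target Q.source ≫ Q.target) ∧
      ∀ U V : LocalicRel.subLoc (R.comp Q),
        LocalicRel.preimage e U ≤ LocalicRel.preimage e V → U ≤ V :=
    LocalicRel.exists_factor_image _
  have hs : e ≫ (R.comp Q).source = pullback.fst R.target Q.source ≫ R.source :=
    (Category.assoc _ _ _).symm.trans ((congrArg (· ≫ prod.fst) he).trans (prod.lift_fst _ _))
  have ht : e ≫ (R.comp Q).target = pullback.snd R.target Q.source ≫ Q.target :=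
    (Category.assoc _ _ _).symm.trans ((congrArg (· ≫ prod.snd) he).trans (prod.lift_snd _ _))
  have hs' := hp.comp hRs
  have ht' := hq.comp hQt
  refine ⟨⟨LocalicRel.IsOpenMap.of_comp (e := e) (by rwa [hs]) hinj,
    LocalicRel.IsOpenMap.of_comp (e := e) (by rwa [ht]) hinj⟩, ?_, ?_⟩
  · funext U
    refine (LocalicRel.lowerAdjoint_preimage_of_comp hs ht ht' hinj U).trans ?_
    refine (congrFun (hq.lowerAdjoint_comp hQt) _).trans ?_
    exact congrArg (LocalicRel.lowerAdjoint Q.target) (bcq _)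
  · funext U
    refine (LocalicRel.lowerAdjoint_preimage_of_comp ht hs hs' hinj U).trans ?_
    refine (congrFun (hp.lowerAdjoint_comp hRs) _).trans ?_
    exact congrArg (LocalicRel.lowerAdjoint R.source) (bcp _)
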